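/- Let $V$ be a finite nonempty set of $n$ agents. A finite collection of EPR pairs is distributed amongst them: each pair consists of two qubits in the state $(|00\rangle+|11\rangle)/\sqrt2$ held by two distinct agents (two agents may share more than one pair), and there is no other prior entanglement. The EPR graph is the undirected graph on $V$ in which two distinct agents are adjacent if and only if they share at least one EPR pair. A pure $n$-partite maximally entangled state is a state of $n$ qubits, one held by each agent, of the form $(\bigotimes_{i\in V}U_i)\,(|00\cdots0\rangle+|11\cdots1\rangle)/\sqrt2$ with unitary $2\times2$ matrices $U_i$. A state can be prepared if some finite protocol of local operations (quantum instruments applied by each agent to its own finite-dimensional system) and classical communication (no transmission of qubits) transforms the distributed EPR pairs into that state with certainty. For every pure $n$-partite maximally entangled state $\psi$: $\psi$ can be prepared amongst the $n$ agents if and only if the EPR graph is connected. -/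

import Mathlib

open scoped Matrix

namespace EPRNet

/-- A finite-dimensional quantum system, given by the finite index type of its computational
(orthonormal) basis; its Hilbert space is `ℂ ^ carrier`. -/
structure Sys where
  carrier : Type
  [fintype : Fintype carrier]
  [decEq : DecidableEq carrier]

attribute [instance] Sys.fintype Sys.decEq

/-- The qubit. -/
abbrev qubit : Sys := { carrier := Fin 2 }

/-- Computational basis of the joint system in which agent `i` holds the system `H i`. The
joint Hilbert space (the tensor product of the local ones) is `ℂ ^ Joint H`. -/
abbrev Joint {V : Type*} (H : V → Sys) : Type _ := ∀ i, (H i).carrier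

/-- The tensor product `⨂ i, A i` of local operators `A i : ℂ ^ H i → ℂ ^ K i`. -/
def tensorOp {V : Type*} [Fintype V] {H K : V → Sys}
    (A : ∀ i, Matrix (K i).carrier (H i).carrier ℂ) : Matrix (Joint K) (Joint H) ℂ :=
  Matrix.of fun x y => ∏ i, A i (x i) (y i)

/-- The rank-one operator `|ψ⟩⟨ψ|`. -/
def pureState {ι : Type*} (ψ : ι → ℂ) : Matrix ι ι ℂ :=
  Matrix.vecMulVec ψ (star ψ)

/-- A quantum instrument from `A` to `B` in Kraus form: a finite set of classical outcomes, for
each outcome `m` the completely positive map `ρ ↦ ∑ l, kraus m l * ρ * (kraus m l)ᴴ`, the sum of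
these maps being trace preserving. It covers appending ancillas, unitaries, measurements,
classical randomness, and discarding subsystems. -/
structure Instrument (A B : Sys) where
  Outcome : Type
  Aux : Type
  [outcomeFintype : Fintype Outcome]
  [auxFintype : Fintype Aux]
  kraus : Outcome → Aux → Matrix B.carrier A.carrier ℂ
  complete : ∑ m, ∑ l, (kraus m l)ᴴ * kraus m l = 1

attribute [instance] Instrument.outcomeFintype Instrument.auxFintype

/-- The unnormalized state of the joint system after every agent `i` has applied the instrument
`I i` to its own system and has obtained the outcome `m i`. -/
def branch {V : Type*} [Fintype V] [DecidableEq V] {H K : V → Sys}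
    (I : ∀ i, Instrument (H i) (K i)) (m : ∀ i, (I i).Outcome)
    (ρ : Matrix (Joint H) (Joint H) ℂ) : Matrix (Joint K) (Joint K) ℂ :=
  ∑ l : ∀ i, (I i).Aux,
    tensorOp (fun i => (I i).kraus (m i) (l i)) * ρ *
      (tensorOp (fun i => (I i).kraus (m i) (l i)))ᴴ

/-- Finite-round protocols of local operations and classical communication that turn local
systems `H` into local systems `K`. In a round each agent applies an instrument (possibly a
trivial one) to its own system and announces the outcome to all agents; the rest of the protocol
may depend on all outcomes announced so far. Information that an agent keeps private is stored in
its own system. -/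
inductive Protocol {V : Type*} (K : V → Sys) : (V → Sys) → Type _
  | done : Protocol K K
  | round {H L : V → Sys} (I : ∀ i, Instrument (H i) (L i))
      (next : (∀ i, (I i).Outcome) → Protocol K L) : Protocol K H

/-- The state that a protocol produces from the initial state `ρ`, averaged over all classical
outcomes. -/
noncomputable def Protocol.output {V : Type*} [Fintype V] [DecidableEq V] {K : V → Sys} :
    {H : V → Sys} → Protocol K H → Matrix (Joint H) (Joint H) ℂ → Matrix (Joint K) (Joint K) ℂ
  | _, .done, ρ => ρ
  | _, .round I next, ρ => ∑ m : (∀ i, (I i).Outcome), (next m).output (branch I m ρ)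

/-- A finite collection of EPR pairs distributed amongst the agents `V`: the qubits of the pair
`p` are held by the two distinct agents `holder p 0` and `holder p 1`. The same two agents may
share several pairs. -/
structure Network (V : Type*) where
  Pair : Type
  [fintype : Fintype Pair]
  [decEq : DecidableEq Pair]
  holder : Pair → Fin 2 → V
  holder_ne : ∀ p, holder p 0 ≠ holder p 1

attribute [instance] Network.fintype Network.decEq

namespace Network

variable {V : Type*} (N : Network V)

/-- The EPR graph: two agents are adjacent iff they share an EPR pair. -/
def graph : SimpleGraph V where
  Adj i j := ∃ p, (N.holder p 0 = i ∧ N.holder p 1 = j) ∨ (N.holder p 0 = j ∧ N.holder p 1 = i)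
  symm := ⟨fun _ _ ⟨p, h⟩ => ⟨p, h.symm⟩⟩
  loopless := ⟨fun _ ⟨p, h⟩ => N.holder_ne p (by rcases h with h | h <;> exact h.1.trans h.2.symm)⟩

/-- The system initially held by agent `i`: its qubits of the EPR pairs it takes part in. -/
def initialSys [DecidableEq V] (i : V) : Sys where
  carrier := {q : N.Pair × Fin 2 // N.holder q.1 q.2 = i} → Fin 2

/-- Value of the qubit `s` of the pair `p` in the joint basis state `x`. -/
def bit [DecidableEq V] (x : Joint N.initialSys) (p : N.Pair) (s : Fin 2) : Fin 2 :=
  x (N.holder p s) ⟨(p, s), rfl⟩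

/-- The initial state vector: every pair `p` is in the state `(|00⟩ + |11⟩) / √2`, and there is
no other entanglement. -/
noncomputable def initialVec [DecidableEq V] (x : Joint N.initialSys) : ℂ :=
  ∏ p, if N.bit x p 0 = N.bit x p 1 then ((1 / √2 : ℝ) : ℂ) else 0

end Network

/-- The state `(|00…0⟩ + |11…1⟩) / √2` of one qubit per agent. -/
noncomputable def ghz (V : Type*) [Fintype V] (x : Joint fun _ : V => qubit) : ℂ :=
  ((1 / √2 : ℝ) : ℂ) *
    ((if ∀ i, x i = 0 then 1 else 0) + (if ∀ i, x i = 1 then 1 else 0))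

/-- Pure maximally entangled states of one qubit per agent: the state
`(|00…0⟩ + |11…1⟩) / √2` up to a local change of orthonormal basis at each agent. -/
def IsMaxEntangled {V : Type*} [Fintype V] [DecidableEq V]
    (ψ : (Joint fun _ : V => qubit) → ℂ) : Prop :=
  ∃ U : V → Matrix.unitaryGroup qubit.carrier ℂ,
    ψ = tensorOp (H := fun _ : V => qubit) (K := fun _ : V => qubit) (fun i => (U i).1) *ᵥ ghz V

/-- The pure state `ψ` of one qubit per agent can be prepared with certainty from the EPR pairs of
`N` by local operations and classical communication. -/
def Preparable {V : Type*} [Fintype V] [DecidableEq V] (N : Network V)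
    (ψ : (Joint fun _ : V => qubit) → ℂ) : Prop :=
  ∃ P : Protocol (fun _ : V => qubit) N.initialSys,
    P.output (pureState N.initialVec) = pureState ψ

end EPRNet

namespace EPRNet

/-! ### Calculus of product operators -/

section Basic

variable {V : Type*} [Fintype V]

/-! Necessity: if the graph is disconnected, no EPR pair crosses the cut between some component and
the rest, so the initial state is separable across it. LOCC acts by sums of product operators and
preserves separability (`Protocol.output_mem_separableCone`), while the GHZ state, and hence each of
its local unitary images, is entangled across every nontrivial cut
(`pureState_ghz_notMem_separableCone`).

Sufficiency: one round of parity measurements and one of corrections suffice. Once agent `i` knows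
its parities, only a common flip `x i` of its qubits is free. The two ends of each pair must agree,
which fixes `x` along edges, so by connectivity up to a global complement (`initialVec_shift`). What
remains is a GHZ state shifted by known bits; undoing the shift and applying `U` gives the target on
every branch of nonzero weight, and the weights sum to 1 (`sum_normSq_amplitude`). -/

lemma pureState_conj {ι κ : Type*} [Fintype ι] (A : Matrix κ ι ℂ) (φ : ι → ℂ) :
    A * pureState φ * Aᴴ = pureState (A *ᵥ φ) := by
  rw [pureState, pureState, Matrix.mul_vecMulVec, Matrix.vecMulVec_mul, Matrix.star_mulVec]

lemma tensorOp_mul [DecidableEq V] {H K L : V → Sys}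
    (A : ∀ i, Matrix (L i).carrier (K i).carrier ℂ)
    (B : ∀ i, Matrix (K i).carrier (H i).carrier ℂ) :
    tensorOp A * tensorOp B = tensorOp fun i => A i * B i := by
  ext x y
  simp only [tensorOp, Matrix.mul_apply, Matrix.of_apply, ← Finset.prod_mul_distrib]
  rw [Finset.prod_univ_sum, Fintype.piFinset_univ]

lemma tensorOp_one {H : V → Sys} :
    tensorOp (fun i => (1 : Matrix (H i).carrier (H i).carrier ℂ)) = 1 := by
  ext x y
  simp only [tensorOp, Matrix.of_apply, Matrix.one_apply, Finset.prod_ite_zero, funext_iff]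
  simp

end Basic

/-! ### Necessity: separability across a cut is preserved by LOCC -/

section Necessity

variable {V : Type*} [Fintype V] [DecidableEq V] (S : V → Prop) [DecidablePred S]

/-- The vector `φ` is a product of a vector of the agents in `S` and one of the other agents. -/
def IsProductAcross {H : V → Sys} (φ : Joint H → ℂ) : Prop :=
  ∃ (f : (∀ i : {i // S i}, (H i).carrier) → ℂ) (g : (∀ i : {i // ¬ S i}, (H i).carrier) → ℂ),
    ∀ x, φ x = f (fun i => x i) * g (fun i => x i)

/-- The cone of unnormalized states that are separable across the cut `S`. -/
def separableCone (H : V → Sys) : AddSubmonoid (Matrix (Joint H) (Joint H) ℂ) :=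
  AddSubmonoid.closure {M | ∃ φ : Joint H → ℂ, IsProductAcross S φ ∧ M = pureState φ}

variable {S}

lemma IsProductAcross.tensorOp_mulVec {H K : V → Sys} {φ : Joint H → ℂ}
    (h : IsProductAcross S φ) (A : ∀ i, Matrix (K i).carrier (H i).carrier ℂ) :
    IsProductAcross S (tensorOp A *ᵥ φ) := by
  obtain ⟨f, g, h⟩ := h
  refine ⟨fun x => ∑ y : (∀ i : {i // S i}, (H i).carrier), (∏ i : {i // S i}, A i (x i) (y i)) * f y,
    fun x => ∑ y : (∀ i : {i // ¬ S i}, (H i).carrier), (∏ i : {i // ¬ S i}, A i (x i) (y i)) * g y,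
    fun x => ?_⟩
  rw [Finset.sum_mul_sum, ← Fintype.sum_prod_type',
    ← (Equiv.piEquivPiSubtypeProd S fun i => (H i).carrier).sum_comp]
  refine Finset.sum_congr rfl fun y _ => ?_
  simp only [tensorOp, Matrix.of_apply, h, Equiv.piEquivPiSubtypeProd_apply]
  rw [← Fintype.prod_subtype_mul_prod_subtype S]
  ring

lemma conj_mem_separableCone {H K : V → Sys} {ρ : Matrix (Joint H) (Joint H) ℂ}
    (hρ : ρ ∈ separableCone S H) (A : ∀ i, Matrix (K i).carrier (H i).carrier ℂ) :
    tensorOp A * ρ * (tensorOp A)ᴴ ∈ separableCone S K := by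
  refine AddSubmonoid.closure_induction ?_ ?_ ?_ hρ
  · rintro _ ⟨φ, hφ, rfl⟩
    exact AddSubmonoid.subset_closure ⟨_, hφ.tensorOp_mulVec A, pureState_conj _ _⟩
  · simp
  · intro a b _ _ ha hb
    rw [Matrix.mul_add, Matrix.add_mul]
    exact add_mem ha hb

/-- Every Kraus branch is a product operator, and closure of the cone under sums absorbs the average
over outcomes. -/
lemma Protocol.output_mem_separableCone {K H : V → Sys} (P : Protocol K H)
    {ρ : Matrix (Joint H) (Joint H) ℂ} (hρ : ρ ∈ separableCone S H) :
    P.output ρ ∈ separableCone S K := by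
  induction P with
  | done => exact hρ
  | round I next ih =>
    exact sum_mem fun m _ => ih m (sum_mem fun l _ => conj_mem_separableCone hρ _)

omit [Fintype V] in
lemma isProductAcross_initialVec (N : Network V)
    (hS : ∀ p, S (N.holder p 0) ↔ S (N.holder p 1)) :
    IsProductAcross S N.initialVec := by
  let e := Equiv.piEquivPiSubtypeProd S fun i => (N.initialSys i).carrier
  let F (x : Joint N.initialSys) (p : N.Pair) : ℂ :=
    if N.bit x p 0 = N.bit x p 1 then ((1 / √2 : ℝ) : ℂ) else 0
  -- Each pair lies on one side of the cut, so the zeros filled in on the other side are never read.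
  refine ⟨fun x => ∏ p, if S (N.holder p 0) then F (e.symm (x, fun _ _ => 0)) p else 1,
    fun x => ∏ p, if S (N.holder p 0) then 1 else F (e.symm (fun _ _ => 0, x)) p, fun x => ?_⟩
  rw [← Finset.prod_mul_distrib]
  refine Finset.prod_congr rfl fun p _ => ?_
  by_cases h : S (N.holder p 0)
  · have h1 := (hS p).1 h
    simp [F, e, Network.bit, h, h1]
  · have h1 : ¬ S (N.holder p 1) := fun h1 => h ((hS p).2 h1)
    simp [F, e, Network.bit, h, h1]

omit [Fintype V] [DecidableEq V] in
lemma IsProductAcross.exchange {H : V → Sys} {φ : Joint H → ℂ} (h : IsProductAcross S φ)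
    (x y : Joint H) :
    φ x * φ y = φ (fun i => if S i then x i else y i) * φ (fun i => if S i then y i else x i) := by
  obtain ⟨f, g, h⟩ := h
  have key (a b : Joint H) : φ (fun i => if S i then a i else b i) =
      f (fun i => a i) * g (fun i => b i) := by
    rw [h]
    congr 2 <;> funext i <;> simp [i.2]
  rw [key, key, h, h]
  ring

omit [Fintype V] [DecidableEq V] in
-- A separability criterion: by `exchange`, a product vector vanishing at the mixed string `z`
-- vanishes at `x` or at `y`, so it contributes no coherence between them.
lemma apply_eq_zero_of_mem_separableCone {H : V → Sys} {ρ : Matrix (Joint H) (Joint H) ℂ}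
    (hρ : ρ ∈ separableCone S H) (x y : Joint H)
    (h0 : (ρ (fun i => if S i then x i else y i) (fun i => if S i then x i else y i)).re = 0) :
    ρ x y = 0 := by
  set z : Joint H := fun i => if S i then x i else y i with hz
  -- Nonnegativity is carried along so that a vanishing sum of diagonal entries forces each summand
  -- to vanish.
  suffices 0 ≤ (ρ z z).re ∧ ((ρ z z).re = 0 → ρ x y = 0) from this.2 h0
  clear h0
  refine AddSubmonoid.closure_induction ?_ ?_ ?_ hρ
  · rintro _ ⟨φ, hφ, rfl⟩
    have hd : (pureState φ z z).re = Complex.normSq (φ z) := by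
      simp [pureState, Matrix.vecMulVec_apply, Complex.normSq_apply]
    rw [hd]
    refine ⟨Complex.normSq_nonneg _, fun h => ?_⟩
    have := hφ.exchange x y
    rw [← hz, Complex.normSq_eq_zero.1 h, zero_mul, mul_eq_zero] at this
    rcases this with h | h <;> simp [pureState, Matrix.vecMulVec_apply, h]
  · simp
  · rintro a b _ _ ⟨ha, ha'⟩ ⟨hb, hb'⟩
    simp only [Matrix.add_apply, Complex.add_re]
    refine ⟨add_nonneg ha hb, fun h => ?_⟩
    rw [ha' (by linarith), hb' (by linarith), add_zero]

omit [DecidableEq V] in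
-- The coherence between `0…0` and `1…1` is nonzero, yet the string mixing them along the cut has
-- weight zero.
lemma pureState_ghz_notMem_separableCone {u v : V} (hu : S u) (hv : ¬ S v) :
    pureState (ghz V) ∉ separableCone S (fun _ => qubit) := by
  intro h
  have : Nonempty V := ⟨u⟩
  have hx : ¬ ∀ i, (if S i then (0 : Fin 2) else 1) = 0 := fun h => by simpa [hv] using h v
  have hy : ¬ ∀ i, (if S i then (0 : Fin 2) else 1) = 1 := fun h => by simpa [hu] using h u
  have := apply_eq_zero_of_mem_separableCone h (fun _ => (0 : Fin 2)) (fun _ => (1 : Fin 2))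
    (by simp only [pureState, Matrix.vecMulVec_apply, ghz, if_neg hx, if_neg hy]; simp)
  simp [pureState, Matrix.vecMulVec_apply, ghz] at this

lemma tensorOp_unitary_conj_pureState (U : V → Matrix.unitaryGroup qubit.carrier ℂ)
    (φ : (Joint fun _ : V => qubit) → ℂ) :
    tensorOp (H := fun _ : V => qubit) (K := fun _ : V => qubit) (fun i => ((U i).1)ᴴ) *
      pureState (tensorOp (H := fun _ : V => qubit) (K := fun _ : V => qubit)
        (fun i => (U i).1) *ᵥ φ) *
      (tensorOp (H := fun _ : V => qubit) (K := fun _ : V => qubit) (fun i => ((U i).1)ᴴ))ᴴ =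
      pureState φ := by
  rw [pureState_conj, Matrix.mulVec_mulVec, tensorOp_mul]
  have (i : V) : ((U i).1)ᴴ * (U i).1 = 1 := Matrix.mem_unitaryGroup_iff'.1 (U i).2
  simp only [this]
  rw [tensorOp_one, Matrix.one_mulVec]

theorem connected_of_preparable [Nonempty V] {N : Network V}
    {ψ : (Joint fun _ : V => qubit) → ℂ} (hψ : IsMaxEntangled ψ) (h : Preparable N ψ) :
    N.graph.Connected := by
  classical
  refine ⟨fun u v => ?_⟩
  by_contra huv
  obtain ⟨U, rfl⟩ := hψ
  obtain ⟨P, hP⟩ := h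
  -- The cut is the connected component of `u`.
  let T : V → Prop := fun i => N.graph.Reachable u i
  have hT (p : N.Pair) : T (N.holder p 0) ↔ T (N.holder p 1) := by
    have : N.graph.Adj (N.holder p 0) (N.holder p 1) := ⟨p, Or.inl ⟨rfl, rfl⟩⟩
    exact ⟨fun h => h.trans this.reachable, fun h => h.trans this.symm.reachable⟩
  have hmem := P.output_mem_separableCone (S := T)
    (AddSubmonoid.subset_closure ⟨_, isProductAcross_initialVec N hT, rfl⟩)
  rw [hP] at hmem
  -- Undoing the unitaries is again a local operation, so the GHZ state itself would be separable.
  have := conj_mem_separableCone (K := fun _ => qubit) hmem (fun i => ((U i).1)ᴴ)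
  rw [tensorOp_unitary_conj_pureState] at this
  exact pureState_ghz_notMem_separableCone (S := T) (SimpleGraph.Reachable.refl u) huv this

end Necessity

/-! ### Sufficiency: parity measurements followed by local corrections -/

section Sufficiency

variable {V : Type*} [Fintype V] [DecidableEq V]

lemma branch_pureState {H K : V → Sys} (I : ∀ i, Instrument (H i) (K i))
    (m : ∀ i, (I i).Outcome) (φ : Joint H → ℂ) :
    branch I m (pureState φ) =
      ∑ l : ∀ i, (I i).Aux, pureState (tensorOp (fun i => (I i).kraus (m i) (l i)) *ᵥ φ) := by
  simp only [branch, pureState_conj]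

lemma pureState_smul {ι : Type*} (s : ℂ) (φ : ι → ℂ) :
    pureState (s • φ) = (Complex.normSq s : ℂ) • pureState φ := by
  ext x y
  simp [pureState, Matrix.vecMulVec_apply, Complex.normSq_eq_conj_mul_self]
  ring

lemma normSq_inv_sqrt_two : Complex.normSq ((1 / √2 : ℝ) : ℂ) = 1 / 2 := by
  rw [Complex.normSq_ofReal, ← sq, div_pow, Real.sq_sqrt zero_le_two, one_pow]

lemma inv_sqrt_two_ne_zero : ((1 / √2 : ℝ) : ℂ) ≠ 0 := by
  rw [← Complex.normSq_pos, normSq_inv_sqrt_two]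
  norm_num

/-- With at least one agent the strings `0…0` and `1…1` differ, so there is no cross term. -/
lemma sum_normSq_ghz [Nonempty V] :
    ∑ x : Joint (fun _ : V => qubit), Complex.normSq (ghz V x) = 1 := by
  have h (x : Joint (fun _ : V => qubit)) : Complex.normSq (ghz V x) =
      (if x = fun _ => 0 then 1 / 2 else 0) + (if x = fun _ => 1 then 1 / 2 else 0) := by
    simp only [ghz, Complex.normSq_mul, normSq_inv_sqrt_two, funext_iff]
    by_cases h0 : ∀ i, x i = 0
    · simp [h0]
    · by_cases h1 : ∀ i, x i = 1 <;> simp [h0, h1]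
  simp only [h, Finset.sum_add_distrib, Finset.sum_ite_eq', Finset.mem_univ, if_true]
  norm_num

namespace Network

variable (N : Network V)

/-- A joint basis state is a family of bits, one for each qubit of each pair. -/
def jointEquiv : Joint N.initialSys ≃ (N.Pair → Fin 2 → Fin 2) where
  toFun x := N.bit x
  invFun y _ q := y q.1.1 q.1.2
  left_inv x := by
    funext i ⟨⟨p, s⟩, h⟩
    subst h
    rfl
  right_inv _ := rfl

lemma sum_normSq_initialVec : ∑ x, Complex.normSq (N.initialVec x) = 1 := by
  have h (x : Joint N.initialSys) : Complex.normSq (N.initialVec x) =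
      ∏ p, if N.jointEquiv x p 0 = N.jointEquiv x p 1 then (1 / 2 : ℝ) else 0 := by
    rw [initialVec, map_prod]
    refine Finset.prod_congr rfl fun p _ => ?_
    change Complex.normSq (if N.bit x p 0 = N.bit x p 1 then _ else _) =
      if N.bit x p 0 = N.bit x p 1 then _ else _
    split_ifs
    · exact normSq_inv_sqrt_two
    · simp
  simp only [h]
  -- In these coordinates the pairs are independent, and the sum of products becomes a product of
  -- sums.
  rw [N.jointEquiv.sum_comp fun y => ∏ p, if y p 0 = y p 1 then (1 / 2 : ℝ) else 0]
  have h2 : ∑ b : Fin 2 → Fin 2, (if b 0 = b 1 then (1 / 2 : ℝ) else 0) = 1 := by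
    rw [← (finTwoArrowEquiv (Fin 2)).symm.sum_comp, Fintype.sum_prod_type]
    simp
  have := Finset.prod_univ_sum (fun _ : N.Pair => (Finset.univ : Finset (Fin 2 → Fin 2)))
    (fun _ b => if b 0 = b 1 then (1 / 2 : ℝ) else 0)
  rw [Fintype.piFinset_univ] at this
  rw [← this, h2, Finset.prod_const_one]

/-- Add the bit `b` to every qubit that agent `i` holds. -/
def localShift (i : V) (b : Fin 2) : (N.initialSys i).carrier ≃ (N.initialSys i).carrier :=
  Equiv.piCongrRight fun _ => Equiv.addRight b

/-- Add the bit `b i` to every qubit that agent `i` holds, for every `i`. -/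
def shift (b : V → Fin 2) : Joint N.initialSys ≃ Joint N.initialSys :=
  Equiv.piCongrRight fun i => N.localShift i (b i)

omit [Fintype V] in
lemma initialVec_eq (x : Joint N.initialSys) : N.initialVec x =
    if ∀ p, N.bit x p 0 = N.bit x p 1 then ((1 / √2 : ℝ) : ℂ) ^ Fintype.card N.Pair else 0 := by
  rw [initialVec, Finset.prod_ite_zero]
  simp

/-- On a connected graph, if `c + b` is in the support of the initial state then `c + x` is in
the support iff `x` equals `b` or its bitwise complement. -/
lemma initialVec_shift [Nonempty V] (hN : N.graph.Connected) {c : Joint N.initialSys}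
    {b : V → Fin 2} (hb : N.initialVec (N.shift b c) ≠ 0) (x : V → Fin 2) :
    N.initialVec (N.shift x c) =
      ((1 / √2 : ℝ) : ℂ) ^ Fintype.card N.Pair *
        ((if ∀ i, x i - b i = 0 then 1 else 0) + (if ∀ i, x i - b i = 1 then 1 else 0)) := by
  rw [initialVec_eq] at hb ⊢
  have hb' := by_contra fun h => hb (if_neg h)
  have hbit (y : V → Fin 2) (p : N.Pair) (s : Fin 2) :
      N.bit (N.shift y c) p s = N.bit c p s + y (N.holder p s) := rfl
  simp only [hbit] at hb' ⊢
  -- Subtracting the same equations for `b` eliminates `c`.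
  have hagree : (∀ p, N.bit c p 0 + x (N.holder p 0) = N.bit c p 1 + x (N.holder p 1)) ↔
      ∀ p, x (N.holder p 0) - b (N.holder p 0) = x (N.holder p 1) - b (N.holder p 1) := by
    have key : ∀ k l s t u v : Fin 2, k + s = l + t → (k + u = l + v ↔ u - s = v - t) := by
      decide
    exact forall_congr' fun p => key _ _ _ _ _ _ (hb' p)
  have hconst : (∀ p, x (N.holder p 0) - b (N.holder p 0) = x (N.holder p 1) - b (N.holder p 1)) ↔
      (∀ i, x i - b i = 0) ∨ (∀ i, x i - b i = 1) := by
    constructor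
    · intro h
      have hreach (i j : V) : x i - b i = x j - b j := by
        obtain ⟨w⟩ := hN.preconnected i j
        induction w with
        | nil => rfl
        | cons hadj _ ih =>
          rw [← ih]
          obtain ⟨p, ⟨rfl, rfl⟩ | ⟨rfl, rfl⟩⟩ := hadj
          exacts [h p, (h p).symm]
      obtain ⟨i0⟩ := ‹Nonempty V›
      have h2 : ∀ a : Fin 2, a = 0 ∨ a = 1 := by decide
      exact (h2 (x i0 - b i0)).imp (fun h i => (hreach i i0).trans h)
        (fun h i => (hreach i i0).trans h)
    · rintro (h | h) p <;> rw [h, h]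
  rw [if_congr (hagree.trans hconst) rfl rfl]
  by_cases h0 : ∀ i, x i - b i = 0
  · simp [h0]
  · by_cases h1 : ∀ i, x i - b i = 1 <;> simp [h0, h1]

/-- The measurement of all pairwise parities of the qubits of agent `i`, after which the two
basis states `c` and `c + 1` that are left are mapped to the basis of one qubit. -/
noncomputable def parityInstrument (i : V) : Instrument (N.initialSys i) qubit where
  Outcome := (N.initialSys i).carrier
  Aux := Unit
  -- Each `y` equals `localShift i b c` for exactly two pairs `(b, c)`, one for each `b`; the factor
  -- makes their weights sum to 1.
  kraus c _ := Matrix.of fun b y => if N.localShift i b c = y then ((1 / √2 : ℝ) : ℂ) else 0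
  complete := by
    ext y z
    have hs : (starRingEnd ℂ) ((1 / √2 : ℝ) : ℂ) * ((1 / √2 : ℝ) : ℂ) = 1 / 2 := by
      rw [← Complex.normSq_eq_conj_mul_self, normSq_inv_sqrt_two]; norm_num
    have key (b : Fin 2) : ∑ c : (N.initialSys i).carrier,
        (star (if N.localShift i b c = y then ((1 / √2 : ℝ) : ℂ) else 0)) *
          (if N.localShift i b c = z then ((1 / √2 : ℝ) : ℂ) else 0) =
        if y = z then 1 / 2 else 0 := by
      rw [(N.localShift i b).sum_comp fun w => star (if w = y then ((1 / √2 : ℝ) : ℂ) else 0) *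
        (if w = z then ((1 / √2 : ℝ) : ℂ) else 0)]
      rw [Finset.sum_eq_single y (fun w _ hw => by simp [hw]) (by simp)]
      by_cases h : y = z
      · simpa [h] using hs
      · simp [h]
    simp only [Matrix.sum_apply, Matrix.mul_apply, Matrix.conjTranspose_apply, Matrix.of_apply,
      Finset.univ_unique, Finset.sum_singleton, Matrix.one_apply]
    rw [Finset.sum_comm]
    refine (Finset.sum_congr rfl fun b _ => key b).trans ?_
    by_cases h : y = z <;> simp [h]

lemma tensorOp_parity_mulVec (c : Joint N.initialSys) (φ : Joint N.initialSys → ℂ)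
    (x : Joint fun _ : V => qubit) :
    (tensorOp (K := fun _ => qubit) (fun i => (N.parityInstrument i).kraus (c i) ()) *ᵥ φ) x =
      ((1 / √2 : ℝ) : ℂ) ^ Fintype.card V * φ (N.shift x c) := by
  have h (y : Joint N.initialSys) :
      tensorOp (K := fun _ => qubit) (fun i => (N.parityInstrument i).kraus (c i) ()) x y =
        if N.shift x c = y then ((1 / √2 : ℝ) : ℂ) ^ Fintype.card V else 0 := by
    change ∏ i, (if N.localShift i (x i) (c i) = y i then ((1 / √2 : ℝ) : ℂ) else 0) = _
    rw [Finset.prod_ite_zero]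
    simp only [Finset.mem_univ, true_imp_iff, Finset.prod_const, Finset.card_univ]
    exact if_congr funext_iff.symm rfl rfl
  simp [Matrix.mulVec, dotProduct, h]

end Network

/-- The local correction `U X ^ b`. -/
noncomputable def correction (U : Matrix.unitaryGroup qubit.carrier ℂ) (b : Fin 2) :
    Instrument qubit qubit where
  Outcome := Unit
  Aux := Unit
  kraus _ _ := U.1.submatrix id (Equiv.subRight b)
  complete := by
    have : (U.1)ᴴ * U.1 = 1 := Matrix.mem_unitaryGroup_iff'.1 U.2
    simp only [Finset.univ_unique, Finset.sum_singleton, Matrix.conjTranspose_submatrix]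
    exact (Matrix.submatrix_mul_equiv _ _ _ (Equiv.refl _) _).trans (by rw [this]; simp)

lemma tensorOp_correction_mulVec (U : V → Matrix.unitaryGroup qubit.carrier ℂ) (b : V → Fin 2)
    (φ : (Joint fun _ : V => qubit) → ℂ) :
    tensorOp (H := fun _ : V => qubit) (K := fun _ : V => qubit)
        (fun i => (correction (U i) (b i)).kraus () ()) *ᵥ (fun x => φ fun i => x i - b i) =
      tensorOp (H := fun _ : V => qubit) (K := fun _ : V => qubit) (fun i => (U i).1) *ᵥ φ := by
  funext x
  let e : (Joint fun _ : V => qubit) ≃ (Joint fun _ : V => qubit) :=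
    Equiv.piCongrRight fun i => Equiv.subRight (b i)
  exact e.sum_comp fun y => tensorOp (H := fun _ : V => qubit) (K := fun _ : V => qubit)
    (fun i => (U i).1) x y * φ y

/-- Bits that turn the outcomes `c` of the parity measurements into a basis state in the support
of the initial state, if there are any. -/
noncomputable def Network.offset (N : Network V) (c : Joint N.initialSys) : V → Fin 2 :=
  Classical.epsilon fun b => N.initialVec (N.shift b c) ≠ 0

/-- All agents measure the parities of their qubits and announce them, then correct their one
remaining qubit. -/
noncomputable def ghzProtocol (N : Network V) (U : V → Matrix.unitaryGroup qubit.carrier ℂ) :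
    Protocol (fun _ : V => qubit) N.initialSys :=
  .round N.parityInstrument fun c => .round (fun i => correction (U i) (N.offset c i)) fun _ => .done

/-- The amplitude of the outcomes `c` of the parity measurements. -/
noncomputable def Network.amplitude (N : Network V) (c : Joint N.initialSys) : ℂ :=
  if ∃ b, N.initialVec (N.shift b c) ≠ 0 then
    -- One factor per agent from its Kraus operator and one per pair from the initial state; the
    -- division removes the factor already contained in `ghz`.
    ((1 / √2 : ℝ) : ℂ) ^ Fintype.card V * ((1 / √2 : ℝ) : ℂ) ^ Fintype.card N.Pair / ((1 / √2 : ℝ) : ℂ)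
  else 0

/-- If some shift of `c` lies in the support, `initialVec_shift` with `b` the offset leaves exactly
two complementary terms; otherwise both sides vanish. -/
lemma Network.tensorOp_parity_mulVec_initialVec [Nonempty V] (N : Network V)
    (hN : N.graph.Connected) (c : Joint N.initialSys) :
    tensorOp (K := fun _ => qubit) (fun i => (N.parityInstrument i).kraus (c i) ()) *ᵥ
      N.initialVec = N.amplitude c • fun x => ghz V fun i => x i - N.offset c i := by
  funext x
  rw [N.tensorOp_parity_mulVec, Pi.smul_apply, smul_eq_mul, amplitude]
  split_ifs with h
  · rw [N.initialVec_shift hN (Classical.epsilon_spec h : N.initialVec (N.shift (N.offset c) c) ≠ 0),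
      ghz]
    have := inv_sqrt_two_ne_zero
    generalize ((1 / √2 : ℝ) : ℂ) = s at this ⊢
    rw [← mul_assoc, ← mul_assoc, div_mul_cancel₀ _ this]
    rfl
  · have : N.initialVec (N.shift x c) = 0 := by_contra fun h' => h ⟨x, h'⟩
    rw [this, mul_zero, zero_mul]

/-- Since GHZ has norm 1, the squared amplitude is the squared norm of the measured vector. Summed
over `c`, each of the `2 ^ n` shifts `x` permutes the basis and contributes `2 ^ (-n)`, where `n` is
the number of agents. -/
lemma Network.sum_normSq_amplitude [Nonempty V] (N : Network V) (hN : N.graph.Connected) :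
    ∑ c, Complex.normSq (N.amplitude c) = 1 := by
  have h (c : Joint N.initialSys) : Complex.normSq (N.amplitude c) =
      ∑ x : V → Fin 2, (1 / 2) ^ Fintype.card V * Complex.normSq (N.initialVec (N.shift x c)) := by
    let e : (V → Fin 2) ≃ (V → Fin 2) :=
      Equiv.piCongrRight fun i => Equiv.subRight (N.offset c i)
    calc Complex.normSq (N.amplitude c)
      _ = Complex.normSq (N.amplitude c) * ∑ x : V → Fin 2, Complex.normSq (ghz V (e x)) := by
        rw [e.sum_comp fun x => Complex.normSq (ghz V x)]
        exact (mul_one _).symm.trans (congrArg _ sum_normSq_ghz.symm)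
      _ = _ := by
        rw [Finset.mul_sum]
        refine Finset.sum_congr rfl fun x _ => ?_
        have := congrFun (N.tensorOp_parity_mulVec_initialVec hN c) x
        rw [N.tensorOp_parity_mulVec] at this
        rw [← normSq_inv_sqrt_two, ← map_pow, ← map_mul, ← map_mul, this]
        rfl
  simp only [h]
  rw [Finset.sum_comm]
  simp only [← Finset.mul_sum]
  have (x : V → Fin 2) : ∑ c, Complex.normSq (N.initialVec (N.shift x c)) = 1 := by
    rw [(N.shift x).sum_comp fun c => Complex.normSq (N.initialVec c), N.sum_normSq_initialVec]
  simp [this]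

theorem preparable_of_connected [Nonempty V] {N : Network V}
    {ψ : (Joint fun _ : V => qubit) → ℂ} (hψ : IsMaxEntangled ψ) (hN : N.graph.Connected) :
    Preparable N ψ := by
  obtain ⟨U, rfl⟩ := hψ
  set ψ := tensorOp (H := fun _ : V => qubit) (K := fun _ : V => qubit) (fun i => (U i).1) *ᵥ ghz V
  refine ⟨ghzProtocol N U, ?_⟩
  have hround1 (c : Joint N.initialSys) : branch N.parityInstrument c (pureState N.initialVec) =
      pureState (N.amplitude c • fun x => ghz V fun i => x i - N.offset c i) := by
    refine (branch_pureState _ _ _).trans ?_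
    rw [← N.tensorOp_parity_mulVec_initialVec hN c]
    exact Fintype.sum_unique (ι := V → Unit) _
  have hround2 (c : Joint N.initialSys) :
      branch (fun i => correction (U i) (N.offset c i)) (fun _ => ())
        (pureState (N.amplitude c • fun x => ghz V fun i => x i - N.offset c i)) =
      (Complex.normSq (N.amplitude c) : ℂ) • pureState ψ := by
    refine (branch_pureState _ _ _).trans ?_
    have hcorr : ψ = _ := (tensorOp_correction_mulVec U (N.offset c) (ghz V)).symm
    rw [← pureState_smul, hcorr, ← Matrix.mulVec_smul]
    exact Fintype.sum_unique (ι := V → Unit) _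
  calc (ghzProtocol N U).output (pureState N.initialVec)
    _ = ∑ c : Joint N.initialSys, branch (fun i => correction (U i) (N.offset c i)) (fun _ => ())
          (branch N.parityInstrument c (pureState N.initialVec)) :=
      Finset.sum_congr rfl fun c _ => Fintype.sum_unique (ι := V → Unit) _
    _ = ∑ c : Joint N.initialSys, (Complex.normSq (N.amplitude c) : ℂ) • pureState ψ :=
      Finset.sum_congr rfl fun c _ => by rw [hround1, hround2]
    _ = pureState ψ := by
      rw [← Finset.sum_smul, ← Complex.ofReal_sum, N.sum_normSq_amplitude hN, Complex.ofReal_one,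
        one_smul]

end Sufficiency

end EPRNet

theorem theorem4 {V : Type*} [Fintype V] [DecidableEq V] [Nonempty V]
    (N : EPRNet.Network V) (ψ : (EPRNet.Joint fun _ : V => EPRNet.qubit) → ℂ)
    (hψ : EPRNet.IsMaxEntangled ψ) :
    EPRNet.Preparable N ψ ↔ N.graph.Connected :=
  ⟨EPRNet.connected_of_preparable hψ, EPRNet.preparable_of_connected hψ⟩
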